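/- Let $0\le k\le n$ be integers. Let $\mathcal S(\mathbb R^m)$ be the Schwartz space of complex-valued functions on $\mathbb R^m$, and let $\mathcal S'(\mathbb R^m)$ be the space of tempered distributions, i.e. continuous $\mathbb C$-linear functionals $\mathcal S(\mathbb R^m)\to\mathbb C$. For $g_1\in\mathcal S'(\mathbb R^k)$ and $g_2\in\mathcal S'(\mathbb R^{n-k})$ let $g_1\otimes g_2\in\mathcal S'(\mathbb R^n)$ be their tensor product, the unique distribution with $\langle g_1\otimes g_2,\phi_1\otimes\phi_2\rangle=\langle g_1,\phi_1\rangle\langle g_2,\phi_2\rangle$ for all $\phi_1\in\mathcal S(\mathbb R^k)$, $\phi_2\in\mathcal S(\mathbb R^{n-k})$, where $(\phi_1\otimes\phi_2)(\mathbf x,\mathbf y)=\phi_1(\mathbf x)\phi_2(\mathbf y)$. Let $\delta^{n-k}$ be the Dirac delta at the origin of $\mathbb R^{n-k}$. For an orthogonal matrix $U\in\mathbb R^{n\times n}$ and $g\in\mathcal S'(\mathbb R^n)$ define $g_U\in\mathcal S'(\mathbb R^n)$ by $\langle g_U,\phi\rangle=\langle g,\phi(U^T\,\cdot)\rangle$.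 Put $$\mathcal G'_k=\{(f\otimes\delta^{n-k})_U \mid f\in\mathcal S'(\mathbb R^k),\ U\in\mathbb R^{n\times n},\ U^TU=I_n\}.$$ For $T\in\mathcal S'(\mathbb R^n)$ let $x_iT$ be the product of $T$ with the $i$-th coordinate function, $\langle x_iT,\phi\rangle=\langle T,x_i\phi\rangle$. Then for every $T\in\mathcal S'(\mathbb R^n)$, $$T\in\mathcal G'_k\iff \dim_{\mathbb R}\operatorname{span}_{\mathbb R}\{x_1T,\dots,x_nT\}\le k .$$ -/

import Mathlib

open SchwartzMap LineDeriv
open scoped ContDiff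


noncomputable section

namespace TensorDistribution

variable {V E F : Type*} [NormedAddCommGroup V] [NormedSpace ℝ V]
  [NormedAddCommGroup E] [NormedSpace ℝ E] [NormedAddCommGroup F] [NormedSpace ℝ F]

theorem hasTemperateGrowth_prodMk (x : E) : (fun y : F => (x, y)).HasTemperateGrowth := by
  have h := (ContinuousLinearMap.inr ℝ E F).hasTemperateGrowth.add
    (Function.HasTemperateGrowth.const (x, (0 : F)))
  convert h using 1
  ext y <;> simp

/-- The function `y ↦ φ(x, y)` for fixed `x`. -/
def slice (x : E) : 𝓢(E × F, ℂ) →L[ℂ] 𝓢(F, ℂ) :=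
  compCLMOfAntilipschitz (K := 1) ℂ (g := fun y : F => (x, y)) (hasTemperateGrowth_prodMk x)
    (AntilipschitzWith.of_le_mul_dist fun y z => by simp [Prod.dist_eq])

theorem slice_apply (x : E) (φ : 𝓢(E × F, ℂ)) (y : F) : slice x φ y = φ (x, y) := rfl

theorem norm_iteratedFDeriv_slice_le (x : E) (φ : 𝓢(E × F, ℂ)) (q : ℕ) (y : F) :
    ‖iteratedFDeriv ℝ q (slice x φ) y‖ ≤ ‖iteratedFDeriv ℝ q φ (x, y)‖ := by
  have h : (slice x φ : F → ℂ) =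
      (fun w : E × F => φ ((x, 0) + w)) ∘ (ContinuousLinearMap.inr ℝ E F) := by
    ext z; simp [slice_apply]
  have hs : ContDiff ℝ ∞ (fun w : E × F => φ ((x, 0) + w)) :=
    (φ.smooth ⊤).comp (contDiff_const.add contDiff_id)
  rw [h, ContinuousLinearMap.iteratedFDeriv_comp_right _ hs y (i := q) (mod_cast le_top),
    iteratedFDeriv_comp_add_left]
  refine (ContinuousMultilinearMap.norm_compContinuousLinearMap_le _ _).trans ?_
  have h1 : ∏ _i : Fin q, ‖ContinuousLinearMap.inr ℝ E F‖ ≤ 1 :=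
    Finset.prod_le_one (fun _ _ => norm_nonneg _) fun _ _ =>
      ContinuousLinearMap.opNorm_le_bound _ zero_le_one fun z => by simp
  simpa using mul_le_mul_of_nonneg_left h1 (norm_nonneg (iteratedFDeriv ℝ q φ (x, y)))

theorem pow_mul_seminorm_slice_le (φ : 𝓢(E × F, ℂ)) (k p q : ℕ) (x : E) :
    ‖x‖ ^ k * SchwartzMap.seminorm ℂ p q (slice x φ) ≤
      SchwartzMap.seminorm ℂ (k + p) q φ := by
  have hx : ‖x‖ ^ k * SchwartzMap.seminorm ℂ p q (slice x φ) =
      SchwartzMap.seminorm ℂ p q ((((‖x‖ ^ k : ℝ)) : ℂ) • slice x φ) := by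
    rw [map_smul_eq_mul]; simp
  rw [hx]
  refine SchwartzMap.seminorm_le_bound ℂ p q _ (apply_nonneg _ _) fun y => ?_
  have h2 : ‖iteratedFDeriv ℝ q ((((‖x‖ ^ k : ℝ)) : ℂ) • slice x φ) y‖ =
      ‖x‖ ^ k * ‖iteratedFDeriv ℝ q (slice x φ) y‖ := by
    rw [FunLike.coe_smul, iteratedFDeriv_const_smul_apply ((slice x φ).contDiffAt q), norm_smul]
    simp
  rw [h2]
  have hx' : ‖x‖ ≤ ‖(x, y)‖ := norm_fst_le (x, y)
  have hy' : ‖y‖ ≤ ‖(x, y)‖ := norm_snd_le (x, y)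
  calc ‖y‖ ^ p * (‖x‖ ^ k * ‖iteratedFDeriv ℝ q (slice x φ) y‖)
      ≤ ‖(x, y)‖ ^ p * (‖(x, y)‖ ^ k * ‖iteratedFDeriv ℝ q φ (x, y)‖) := by
        gcongr
        exact norm_iteratedFDeriv_slice_le x φ q y
    _ = ‖(x, y)‖ ^ (k + p) * ‖iteratedFDeriv ℝ q φ (x, y)‖ := by ring
    _ ≤ _ := φ.le_seminorm ℂ _ _ _

theorem norm_iteratedFDeriv_lineDeriv_le (φ : 𝓢(V, ℂ)) (v : V) (q : ℕ) (z : V) :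
    ‖iteratedFDeriv ℝ q (∂_{v} φ : 𝓢(V, ℂ)) z‖ ≤ ‖v‖ * ‖iteratedFDeriv ℝ (q + 1) φ z‖ := by
  have h : ((∂_{v} φ : 𝓢(V, ℂ)) : V → ℂ) =
      (ContinuousLinearMap.apply ℝ ℂ v) ∘ (fderiv ℝ φ) := by
    ext w; rfl
  have hs : ContDiff ℝ ∞ (fderiv ℝ φ) := (fderivCLM ℝ V ℂ φ).smooth ⊤
  rw [h]
  refine (ContinuousLinearMap.norm_iteratedFDeriv_comp_left _ (N := ∞) hs.contDiffAt
    (mod_cast le_top)).trans ?_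
  rw [norm_iteratedFDeriv_fderiv]
  gcongr
  exact ContinuousLinearMap.opNorm_le_bound _ (norm_nonneg _) fun L => by
    simpa [mul_comm] using L.le_opNorm v

theorem seminorm_lineDeriv_le (φ : 𝓢(V, ℂ)) (v : V) (p q : ℕ) :
    SchwartzMap.seminorm ℂ p q (∂_{v} φ : 𝓢(V, ℂ)) ≤
      ‖v‖ * SchwartzMap.seminorm ℂ p (q + 1) φ := by
  refine SchwartzMap.seminorm_le_bound ℂ p q _ (by positivity) fun z => ?_
  calc _ ≤ ‖z‖ ^ p * (‖v‖ * ‖iteratedFDeriv ℝ (q + 1) φ z‖) := by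
        gcongr; exact norm_iteratedFDeriv_lineDeriv_le φ v q z
    _ = ‖v‖ * (‖z‖ ^ p * ‖iteratedFDeriv ℝ (q + 1) φ z‖) := by ring
    _ ≤ _ := by gcongr; exact φ.le_seminorm ℂ _ _ _

theorem seminorm_iteratedLineDeriv_le (φ : 𝓢(V, ℂ)) (p q n : ℕ) (m : Fin n → V) :
    SchwartzMap.seminorm ℂ p q (∂^{m} φ : 𝓢(V, ℂ)) ≤
      (∏ i, ‖m i‖) * SchwartzMap.seminorm ℂ p (q + n) φ := by
  induction n generalizing q with
  | zero => simp
  | succ n ih =>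
    rw [iteratedLineDerivOp_succ_left, Fin.prod_univ_succ]
    refine (seminorm_lineDeriv_le _ _ _ _).trans ?_
    rw [mul_assoc, show q + (n + 1) = (q + 1) + n by ring]
    gcongr
    exact ih _ _

theorem lineDeriv_comm (φ : 𝓢(V, ℂ)) (v w : V) :
    (∂_{v} (∂_{w} φ : 𝓢(V, ℂ)) : 𝓢(V, ℂ)) = ∂_{w} (∂_{v} φ : 𝓢(V, ℂ)) := by
  have key : ∀ (a b : V) (z : V), (∂_{a} (∂_{b} φ : 𝓢(V, ℂ)) : 𝓢(V, ℂ)) z =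
      fderiv ℝ (fderiv ℝ φ) z a b := by
    intro a b z
    rw [lineDerivOp_apply_eq_fderiv]
    have h : ((∂_{b} φ : 𝓢(V, ℂ)) : V → ℂ) = fun w => fderiv ℝ φ w b := rfl
    have hd : DifferentiableAt ℝ (fderiv ℝ φ) z := (fderivCLM ℝ V ℂ φ).differentiableAt
    rw [h, fderiv_clm_apply hd (differentiableAt_const b)]
    simp
  ext z
  rw [key, key]
  have : IsSymmSndFDerivAt ℝ φ z :=
    (φ.contDiffAt (2 : ℕ)).isSymmSndFDerivAt (by simp)
  exact this v w

theorem iteratedLineDeriv_lineDeriv_comm (φ : 𝓢(V, ℂ)) (v : V) (n : ℕ) (m : Fin n → V) :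
    (∂^{m} (∂_{v} φ : 𝓢(V, ℂ)) : 𝓢(V, ℂ)) = ∂_{v} (∂^{m} φ : 𝓢(V, ℂ)) := by
  induction n with
  | zero => simp
  | succ n ih =>
    rw [iteratedLineDerivOp_succ_left, iteratedLineDerivOp_succ_left, ih, lineDeriv_comm]

theorem iteratedFDeriv_lineDeriv (φ : 𝓢(V, ℂ)) (v : V) (q : ℕ) (z : V) :
    iteratedFDeriv ℝ q (∂_{v} φ : 𝓢(V, ℂ)) z = fderiv ℝ (iteratedFDeriv ℝ q φ) z v := by
  ext m
  rw [← iteratedLineDerivOp_eq_iteratedFDeriv, iteratedLineDeriv_lineDeriv_comm,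
    lineDerivOp_apply_eq_fderiv, ← fderiv_continuousMultilinear_apply_const_apply]
  · simp only [← iteratedLineDerivOp_eq_iteratedFDeriv]
  · exact (φ.smooth ⊤).differentiable_iteratedFDeriv (mod_cast ENat.natCast_lt_top q) z

/-- The first-order Taylor remainder `z ↦ φ(z + v) - φ(z) - ∂_v φ(z)`. -/
def rem (φ : 𝓢(V, ℂ)) (v : V) : 𝓢(V, ℂ) := compSubConstCLM ℂ (-v) φ - φ - ∂_{v} φ

theorem rem_apply (φ : 𝓢(V, ℂ)) (v z : V) : rem φ v z = φ (z + v) - φ z - fderiv ℝ φ z v := by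
  simp [rem, lineDerivOp_apply_eq_fderiv]

theorem norm_iteratedFDeriv_rem_le (φ : 𝓢(V, ℂ)) (v z : V) (q : ℕ) (M : ℝ)
    (hM : ∀ w ∈ segment ℝ z (z + v), ‖iteratedFDeriv ℝ (q + 2) φ w‖ ≤ M) :
    ‖iteratedFDeriv ℝ q (rem φ v) z‖ ≤ M * ‖v‖ * ‖v‖ := by
  have hdiff : ∀ r : ℕ, Differentiable ℝ (iteratedFDeriv ℝ r φ) := fun r =>
    (φ.smooth ⊤).differentiable_iteratedFDeriv (mod_cast ENat.natCast_lt_top r)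
  have h1 : iteratedFDeriv ℝ q (rem φ v) z = iteratedFDeriv ℝ q φ (z + v) -
      iteratedFDeriv ℝ q φ z - fderiv ℝ (iteratedFDeriv ℝ q φ) z v := by
    have e : (rem φ v : V → ℂ) = ((fun w => φ (w + v)) - φ) - (∂_{v} φ : 𝓢(V, ℂ)) := by
      ext w; simp [rem]
    have c1 : ContDiffAt ℝ q (fun w => φ (w + v)) z :=
      ((φ.smooth q).comp (contDiff_id.add contDiff_const)).contDiffAt
    have c2 : ContDiffAt ℝ q ((fun w => φ (w + v)) - (⇑φ)) z := c1.sub (φ.contDiffAt q)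
    rw [e, iteratedFDeriv_sub_apply c2 ((∂_{v} φ : 𝓢(V, ℂ)).contDiffAt q),
      iteratedFDeriv_sub_apply c1 (φ.contDiffAt q), iteratedFDeriv_comp_add_right,
      iteratedFDeriv_lineDeriv]
  have hconv := convex_segment (𝕜 := ℝ) z (z + v)
  have hz := left_mem_segment ℝ z (z + v)
  have hzv := right_mem_segment ℝ z (z + v)
  have hM0 : 0 ≤ M := (norm_nonneg _).trans (hM z hz)
  have h2 : ∀ w ∈ segment ℝ z (z + v),
      ‖fderiv ℝ (iteratedFDeriv ℝ q φ) w - fderiv ℝ (iteratedFDeriv ℝ q φ) z‖ ≤ M * ‖v‖ := by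
    intro w hw
    rw [fderiv_iteratedFDeriv]
    simp only [Function.comp_apply]
    rw [← LinearIsometryEquiv.map_sub, LinearIsometryEquiv.norm_map]
    refine (hconv.norm_image_sub_le_of_norm_fderiv_le (𝕜 := ℝ) (C := M)
      (fun u _ => hdiff (q + 1) u)
      (fun u hu => (norm_fderiv_iteratedFDeriv.le).trans (hM u hu)) hz hw).trans ?_
    gcongr
    have := norm_sub_le_of_mem_segment hw
    simpa using this
  have h3 := hconv.norm_image_sub_le_of_norm_fderiv_le' (𝕜 := ℝ) (fun u _ => hdiff q u) h2 hz hzv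
  rw [h1]
  simpa using h3

theorem exists_seminorm_slice_rem_le (φ : 𝓢(E × F, ℂ)) (p q : ℕ) : ∃ K : ℝ, 0 ≤ K ∧
    ∀ x h : E, SchwartzMap.seminorm ℂ p q (slice x (rem φ (h, 0))) ≤ K * (‖h‖ * ‖h‖) := by
  set K : ℝ := 2 ^ p * ((Finset.Iic (p, q + 2)).sup
    fun m => SchwartzMap.seminorm ℂ m.1 m.2) φ with hK
  have hK0 : 0 ≤ K := by positivity
  refine ⟨K, hK0, fun x h => SchwartzMap.seminorm_le_bound ℂ p q _ (by positivity) fun y => ?_⟩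
  have h1 : ‖iteratedFDeriv ℝ q (rem φ (h, (0 : F))) (x, y)‖ ≤
      K / (1 + ‖y‖) ^ p * ‖(h, (0 : F))‖ * ‖(h, (0 : F))‖ := by
    refine norm_iteratedFDeriv_rem_le φ _ _ q _ fun w hw => ?_
    have hw2 : w.2 = y := by
      obtain ⟨a, b, _, _, hab, rfl⟩ := hw
      simp [← add_smul, hab]
    rw [le_div_iff₀' (by positivity)]
    have := SchwartzMap.one_add_le_sup_seminorm_apply (𝕜 := ℂ) (m := (p, q + 2)) le_rfl le_rfl φ w
    refine le_trans ?_ this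
    gcongr
    rw [← hw2]
    exact norm_snd_le w
  have h2 : ‖(h, (0 : F))‖ = ‖h‖ := by simp [Prod.norm_def]
  rw [h2] at h1
  calc ‖y‖ ^ p * ‖iteratedFDeriv ℝ q (slice x (rem φ (h, 0))) y‖
      ≤ (1 + ‖y‖) ^ p * (K / (1 + ‖y‖) ^ p * ‖h‖ * ‖h‖) := by
        gcongr
        · linarith
        · exact (norm_iteratedFDeriv_slice_le _ _ _ _).trans h1
    _ = K * (‖h‖ * ‖h‖) := by
        have : (1 + ‖y‖) ^ p ≠ 0 := by positivity
        field_simp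

theorem exists_norm_le (g : 𝓢'(F, ℂ)) : ∃ (s : Finset (ℕ × ℕ)) (C : ℝ), 0 ≤ C ∧
    ∀ ψ : 𝓢(F, ℂ), ‖g ψ‖ ≤ C * ∑ i ∈ s, SchwartzMap.seminorm ℂ i.1 i.2 ψ := by
  obtain ⟨s, C, -, h⟩ := Seminorm.bound_of_continuous (schwartz_withSeminorms ℂ F ℂ)
    ((normSeminorm ℂ ℂ).comp g.toLinearMap) (continuous_norm.comp g.continuous)
  refine ⟨s, C, C.2, fun ψ => ?_⟩
  refine (h ψ).trans ?_
  rw [_root_.smul_apply, NNReal.smul_def, smul_eq_mul]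
  gcongr
  have := Seminorm.finset_sup_le_sum (schwartzSeminormFamily ℂ F ℂ) s ψ
  refine this.trans (le_of_eq ?_)
  simp [schwartzSeminormFamily]

/-- The function `x ↦ ⟨g, φ(x, ·)⟩`. -/
def partialEval (g : 𝓢'(F, ℂ)) (φ : 𝓢(E × F, ℂ)) (x : E) : ℂ := g (slice x φ)

theorem slice_add_rem (φ : 𝓢(E × F, ℂ)) (x h : E) :
    slice x (rem φ (h, 0)) = slice (x + h) φ - slice x φ - slice x (∂_{(h, (0 : F))} φ) := by
  ext y
  simp [slice_apply, rem]

variable [FiniteDimensional ℝ E]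

theorem hasFDerivAt_partialEval (g : 𝓢'(F, ℂ)) (φ : 𝓢(E × F, ℂ)) (x : E) :
    ∃ L : E →L[ℝ] ℂ, HasFDerivAt (partialEval g φ) L x ∧
      ∀ h, L h = partialEval g (∂_{(h, (0 : F))} φ) x := by
  let L : E →ₗ[ℝ] ℂ :=
    { toFun := fun h => partialEval g (∂_{(h, (0 : F))} φ) x
      map_add' := fun a b => by
        have : ((a + b, 0) : E × F) = (a, 0) + (b, 0) := by simp
        simp only [partialEval]
        rw [this, lineDerivOp_left_add, map_add, map_add]
      map_smul' := fun c a => by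
        have : ((c • a, 0) : E × F) = c • (a, 0) := by simp
        have h2 : (c • (∂_{(a, (0 : F))} φ) : 𝓢(E × F, ℂ)) = (c : ℂ) • ∂_{(a, (0 : F))} φ := by
          ext z; simp
        simp only [partialEval]
        rw [this, lineDerivOp_left_smul, h2, map_smul, map_smul]
        simp }
  refine ⟨L.toContinuousLinearMap, ?_, fun h => rfl⟩
  rw [hasFDerivAt_iff_isLittleO_nhds_zero]
  obtain ⟨s, C, hC, hg⟩ := exists_norm_le g
  choose K hK0 hK using exists_seminorm_slice_rem_le (E := E) (F := F) φ
  have hO : (fun h : E => partialEval g φ (x + h) - partialEval g φ x -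
      L.toContinuousLinearMap h) =O[nhds 0] fun h => ‖h‖ * ‖h‖ := by
    refine Asymptotics.IsBigO.of_bound (C * ∑ i ∈ s, K i.1 i.2) (Filter.Eventually.of_forall ?_)
    intro h
    have e : partialEval g φ (x + h) - partialEval g φ x - L.toContinuousLinearMap h =
        g (slice x (rem φ (h, 0))) := by
      rw [slice_add_rem, map_sub, map_sub]; rfl
    rw [e]
    refine (hg _).trans ?_
    rw [norm_mul, norm_norm, mul_assoc, Finset.sum_mul]
    gcongr with i hi
    exact hK _ _ _ _
  refine hO.trans_isLittleO ?_
  have h1 : (fun h : E => ‖h‖) =o[nhds 0] (fun _ => (1 : ℝ)) := by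
    rw [Asymptotics.isLittleO_one_iff]
    simpa using (continuous_norm (E := E)).tendsto 0
  have h2 := h1.mul_isBigO (Asymptotics.isBigO_refl (fun h : E => ‖h‖) (nhds 0))
  rw [← Asymptotics.isLittleO_norm_right]
  simpa using h2

theorem fderiv_partialEval (g : 𝓢'(F, ℂ)) (φ : 𝓢(E × F, ℂ)) (x h : E) :
    fderiv ℝ (partialEval g φ) x h = partialEval g (∂_{(h, (0 : F))} φ) x := by
  obtain ⟨L, hL, hL'⟩ := hasFDerivAt_partialEval g φ x
  rw [hL.fderiv, hL']

theorem contDiff_partialEval (g : 𝓢'(F, ℂ)) (φ : 𝓢(E × F, ℂ)) :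
    ContDiff ℝ ∞ (partialEval g φ) := by
  rw [contDiff_infty]
  intro n
  induction n generalizing φ with
  | zero =>
    refine contDiff_zero.2 (continuous_iff_continuousAt.2 fun x => ?_)
    obtain ⟨L, hL, -⟩ := hasFDerivAt_partialEval g φ x
    exact hL.continuousAt
  | succ n ih =>
    push_cast
    refine contDiff_succ_iff_fderiv_apply.2 ⟨fun x => ?_, by simp, fun v => ?_⟩
    · obtain ⟨L, hL, -⟩ := hasFDerivAt_partialEval g φ x
      exact hL.differentiableAt
    · simp only [fderiv_partialEval]
      exact ih _

theorem iteratedFDeriv_partialEval (g : 𝓢'(F, ℂ)) (φ : 𝓢(E × F, ℂ)) (n : ℕ) (x : E)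
    (m : Fin n → E) : iteratedFDeriv ℝ n (partialEval g φ) x m =
      partialEval g (∂^{fun i => (m i, (0 : F))} φ) x := by
  induction n generalizing x with
  | zero => simp
  | succ n ih =>
    rw [iteratedLineDerivOp_succ_left, iteratedFDeriv_succ_apply_left,
      ← fderiv_continuousMultilinear_apply_const_apply]
    · simp only [ih, fderiv_partialEval]
      rfl
    · exact (contDiff_partialEval g φ).differentiable_iteratedFDeriv
        (mod_cast ENat.natCast_lt_top n) x

/-- The continuous linear map sending `φ` to the Schwartz function `x ↦ ⟨g, φ(x, ·)⟩`. -/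
def partialEvalCLM (g : 𝓢'(F, ℂ)) : 𝓢(E × F, ℂ) →L[ℂ] 𝓢(E, ℂ) :=
  mkCLM (partialEval g) (fun φ ψ x => by simp [partialEval])
    (fun a φ x => by simp [partialEval]) (contDiff_partialEval g) <| by
  rintro ⟨k, n⟩
  obtain ⟨s, C, hC, hg⟩ := exists_norm_le g
  refine ⟨s.image fun i => (k + i.1, i.2 + n), C * s.card, by positivity, fun φ x => ?_⟩
  set P := (s.image fun i => (k + i.1, i.2 + n)).sup (schwartzSeminormFamily ℂ (E × F) ℂ)
  have hP : ∀ i ∈ s, SchwartzMap.seminorm ℂ (k + i.1) (i.2 + n) φ ≤ P φ := fun i hi =>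
    Finset.le_sup (f := schwartzSeminormFamily ℂ (E × F) ℂ)
      (Finset.mem_image_of_mem (fun i => (k + i.1, i.2 + n)) hi) φ
  have hx : ‖x‖ ^ k * ‖iteratedFDeriv ℝ n (partialEval g φ) x‖ =
      ‖(‖x‖ ^ k) • iteratedFDeriv ℝ n (partialEval g φ) x‖ := by
    rw [norm_smul]; simp
  simp only
  rw [hx]
  refine ContinuousMultilinearMap.opNorm_le_bound (by positivity) fun m => ?_
  rw [_root_.smul_apply, iteratedFDeriv_partialEval, norm_smul]
  have h1 : ∏ i, ‖(m i, (0 : F))‖ = ∏ i, ‖m i‖ := by simp [Prod.norm_def]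
  set ψ : 𝓢(E × F, ℂ) := ∂^{fun i => (m i, (0 : F))} φ with hψ
  calc ‖‖x‖ ^ k‖ * ‖partialEval g ψ x‖
      ≤ ‖x‖ ^ k * (C * ∑ i ∈ s, SchwartzMap.seminorm ℂ i.1 i.2 (slice x ψ)) := by
        rw [norm_pow, norm_norm]
        gcongr
        exact hg _
    _ = C * ∑ i ∈ s, ‖x‖ ^ k * SchwartzMap.seminorm ℂ i.1 i.2 (slice x ψ) := by
        rw [Finset.mul_sum, Finset.mul_sum, Finset.mul_sum]
        refine Finset.sum_congr rfl fun i _ => by ring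
    _ ≤ C * ∑ _i ∈ s, (∏ j, ‖m j‖) * P φ := by
        refine mul_le_mul_of_nonneg_left (Finset.sum_le_sum fun i hi => ?_) hC
        refine (pow_mul_seminorm_slice_le ψ k i.1 i.2 x).trans ?_
        refine (seminorm_iteratedLineDeriv_le φ _ _ _ _).trans ?_
        rw [h1]
        gcongr
        exact hP i hi
    _ = C * s.card * P φ * ∏ i, ‖m i‖ := by
        rw [Finset.sum_const, nsmul_eq_mul]; ring

/-- The tensor product of two tempered distributions:
`⟨g₁ ⊗ g₂, φ⟩ = ⟨g₁, x ↦ ⟨g₂, φ(x, ·)⟩⟩`. -/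
def tensorProd (g₁ : 𝓢'(E, ℂ)) (g₂ : 𝓢'(F, ℂ)) : 𝓢'(E × F, ℂ) :=
  PointwiseConvergenceCLM.precomp ℂ (partialEvalCLM g₂) g₁

/-- The defining rule `⟨g₁ ⊗ g₂, φ₁ ⊗ φ₂⟩ = ⟨g₁, φ₁⟩ ⟨g₂, φ₂⟩`. -/
theorem tensorProd_apply_of_eq_mul (g₁ : 𝓢'(E, ℂ)) (g₂ : 𝓢'(F, ℂ)) (φ₁ : 𝓢(E, ℂ)) (φ₂ : 𝓢(F, ℂ))
    (φ : 𝓢(E × F, ℂ)) (hφ : ∀ x y, φ (x, y) = φ₁ x * φ₂ y) :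
    tensorProd g₁ g₂ φ = g₁ φ₁ * g₂ φ₂ := by
  have h : partialEvalCLM g₂ φ = g₂ φ₂ • φ₁ := by
    ext x
    have hs : slice x φ = φ₁ x • φ₂ := by ext y; simp [slice_apply, hφ]
    change g₂ (slice x φ) = _
    rw [hs, map_smul]
    simp [mul_comm]
  change g₁ (partialEvalCLM g₂ φ) = _
  rw [h, map_smul, smul_eq_mul, mul_comm]

theorem tensorProd_apply (g₁ : 𝓢'(E, ℂ)) (g₂ : 𝓢'(F, ℂ)) (φ : 𝓢(E × F, ℂ)) :
    tensorProd g₁ g₂ φ = g₁ (partialEvalCLM g₂ φ) := rfl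

theorem partialEvalCLM_apply (g : 𝓢'(F, ℂ)) (φ : 𝓢(E × F, ℂ)) (x : E) :
    partialEvalCLM g φ x = g (slice x φ) := rfl

variable {n k : ℕ}

/-- The identification `ℝⁿ ≃ ℝᵏ × ℝⁿ⁻ᵏ`, `x ↦ ((x₁, …, x_k), (x_{k+1}, …, x_n))`. -/
def splitEquiv (hk : k ≤ n) : EuclideanSpace ℝ (Fin n) ≃L[ℝ]
    EuclideanSpace ℝ (Fin k) × EuclideanSpace ℝ (Fin (n - k)) :=
  (LinearIsometryEquiv.piLpCongrLeft 2 ℝ ℝ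
    (finCongr (Nat.add_sub_cancel' hk).symm)).toContinuousLinearEquiv.trans
      EuclideanSpace.finAddEquivProd

theorem splitEquiv_fst (hk : k ≤ n) (x : EuclideanSpace ℝ (Fin n)) (i : Fin k) :
    (splitEquiv hk x).1 i = x (Fin.castLE hk i) := by
  rfl

theorem splitEquiv_snd (hk : k ≤ n) (x : EuclideanSpace ℝ (Fin n)) (j : Fin (n - k)) :
    (splitEquiv hk x).2 j = x ⟨k + j, by omega⟩ := by
  rfl

/-- The tensor product of distributions on `ℝᵏ` and `ℝⁿ⁻ᵏ`, as a distribution on `ℝⁿ`. -/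
def euclideanTensor (hk : k ≤ n) (g₁ : 𝓢'(EuclideanSpace ℝ (Fin k), ℂ))
    (g₂ : 𝓢'(EuclideanSpace ℝ (Fin (n - k)), ℂ)) : 𝓢'(EuclideanSpace ℝ (Fin n), ℂ) :=
  PointwiseConvergenceCLM.precomp ℂ
    (compCLMOfContinuousLinearEquiv ℂ (splitEquiv hk).symm) (tensorProd g₁ g₂)

/-- The linear bijection `x ↦ Uᵀ x` of `ℝⁿ` for an orthogonal matrix `U`. -/
def transposeEquiv (U : Matrix.orthogonalGroup (Fin n) ℝ) :
    EuclideanSpace ℝ (Fin n) ≃L[ℝ] EuclideanSpace ℝ (Fin n) :=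
  ContinuousLinearEquiv.equivOfInverse
    (Matrix.toEuclideanCLM (𝕜 := ℝ) (U : Matrix (Fin n) (Fin n) ℝ).transpose)
    (Matrix.toEuclideanCLM (𝕜 := ℝ) (U : Matrix (Fin n) (Fin n) ℝ))
    (fun x => by
      have h : (U : Matrix (Fin n) (Fin n) ℝ) * (U : Matrix (Fin n) (Fin n) ℝ).transpose = 1 :=
        (Matrix.mem_orthogonalGroup_iff (Fin n) ℝ).1 U.2
      rw [← mul_apply_eq_comp, ← map_mul, h, map_one]; rfl)
    (fun x => by
      have h : (U : Matrix (Fin n) (Fin n) ℝ).transpose * (U : Matrix (Fin n) (Fin n) ℝ) = 1 :=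
        (Matrix.mem_orthogonalGroup_iff' (Fin n) ℝ).1 U.2
      rw [← mul_apply_eq_comp, ← map_mul, h, map_one]; rfl)

/-- The change of variables `⟨g_U, φ⟩ = ⟨g, φ(Uᵀ ·)⟩`. -/
def changeVar (U : Matrix.orthogonalGroup (Fin n) ℝ) (g : 𝓢'(EuclideanSpace ℝ (Fin n), ℂ)) :
    𝓢'(EuclideanSpace ℝ (Fin n), ℂ) :=
  PointwiseConvergenceCLM.precomp ℂ (compCLMOfContinuousLinearEquiv ℂ (transposeEquiv U)) g

/-- The set of all `(f ⊗ δⁿ⁻ᵏ)_U` with `f ∈ 𝓢'(ℝᵏ)` and `U` an orthogonal `n × n` matrix. -/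
def GPrime (hk : k ≤ n) : Set 𝓢'(EuclideanSpace ℝ (Fin n), ℂ) :=
  {T | ∃ (f : 𝓢'(EuclideanSpace ℝ (Fin k), ℂ)) (U : Matrix.orthogonalGroup (Fin n) ℝ),
    T = changeVar U (euclideanTensor hk f (TemperedDistribution.delta 0))}

/-- The product `x_i T` of a distribution with the `i`-th coordinate function. -/
def coordMul (i : Fin n) (T : 𝓢'(EuclideanSpace ℝ (Fin n), ℂ)) :
    𝓢'(EuclideanSpace ℝ (Fin n), ℂ) :=
  TemperedDistribution.smulLeftCLM ℂ (fun x => ((x i : ℝ) : ℂ)) T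

theorem coord_hasTemperateGrowth (i : Fin n) :
    (fun x : EuclideanSpace ℝ (Fin n) => ((x i : ℝ) : ℂ)).HasTemperateGrowth :=
  (Complex.ofRealCLM.comp
    (EuclideanSpace.proj i : EuclideanSpace ℝ (Fin n) →L[ℝ] ℝ)).hasTemperateGrowth

theorem coordMul_apply (i : Fin n) (T : 𝓢'(EuclideanSpace ℝ (Fin n), ℂ))
    (φ ψ : 𝓢(EuclideanSpace ℝ (Fin n), ℂ)) (hψ : ∀ x, ψ x = (x i : ℂ) * φ x) :
    coordMul i T φ = T ψ := by
  have h : SchwartzMap.smulLeftCLM ℂ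
      (fun x : EuclideanSpace ℝ (Fin n) => ((x i : ℝ) : ℂ)) φ = ψ := by
    ext x
    rw [SchwartzMap.smulLeftCLM_apply_apply (coord_hasTemperateGrowth i), hψ, smul_eq_mul]
  rw [coordMul, TemperedDistribution.smulLeftCLM_apply_apply, h]

end TensorDistribution

end

/-! An orthogonal change of variables mixes the products `x_i T` linearly (`coordMul_changeVar`), so
everything reduces to distributions annihilated by the last `n - k` coordinates. Such distributions
are exactly those of the form `f ⊗ δ`. One direction is evaluation at `y = 0`; the other is a
division argument (`apply_eq_apply_tensorRight`). To compare `φ(x, y)` with `φ(x, 0) χ(y)`, where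
`χ(0) = 1`, join them by the path `φ(x, t y) χ((1 - t) y)`. Its `t`-derivative is a sum of `y_j`
times Schwartz functions, which `T` kills if every `y_j T = 0`. Hence `T φ` depends only on `φ(·,
0)`.

If `T = (f ⊗ δ)_U`, each `x_i T` is a combination of the `k` transformed products with the first
coordinates, which bounds the dimension. Conversely, if the span has dimension at most `k`, the
kernel of `c ↦ ∑ c_i x_i T` has dimension at least `n - k`. An orthogonal `U` whose last `n - k`
rows lie in that kernel (`exists_orthogonal_rows_mem`) turns `T` into a distribution killed by the
last coordinates, and division applies. -/

namespace TensorDistribution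

/-! ### Tensor products of Schwartz functions -/

section SchwartzTensor

variable {V E F : Type*} [NormedAddCommGroup V] [NormedSpace ℝ V]
  [NormedAddCommGroup E] [NormedSpace ℝ E] [NormedAddCommGroup F] [NormedSpace ℝ F]

theorem norm_iteratedFDeriv_comp_clm_le (φ : 𝓢(E, ℂ)) (L : V →L[ℝ] E) (hL : ‖L‖ ≤ 1) (q : ℕ)
    (z : V) : ‖iteratedFDeriv ℝ q (fun w => φ (L w)) z‖ ≤ ‖iteratedFDeriv ℝ q φ (L z)‖ := by
  have h := ContinuousLinearMap.iteratedFDeriv_comp_right L (φ.smooth ⊤) z (i := q)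
    (mod_cast le_top)
  rw [show (fun w => φ (L w)) = φ ∘ L from rfl, h]
  refine (ContinuousMultilinearMap.norm_compContinuousLinearMap_le _ _).trans ?_
  exact mul_le_of_le_one_right (norm_nonneg _)
    (Finset.prod_le_one (fun _ _ => norm_nonneg _) fun _ _ => hL)

/-- The map `φ ↦ φ ⊗ χ` on Schwartz functions. -/
noncomputable def tensorRight (χ : 𝓢(F, ℂ)) : 𝓢(E, ℂ) →L[ℂ] 𝓢(E × F, ℂ) :=
  mkCLM (fun φ z => φ z.1 * χ z.2) (fun φ ψ z => by simp [add_mul])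
    (fun a φ z => by simp [mul_assoc])
    (fun φ => ((φ.smooth ⊤).comp contDiff_fst).mul ((χ.smooth ⊤).comp contDiff_snd)) <| by
  rintro ⟨p, q⟩
  set Q := (Finset.Iic (p, q)).sup (schwartzSeminormFamily ℂ F ℂ) χ with hQ
  have hQ0 : 0 ≤ Q := apply_nonneg _ _
  -- The factor `2 ^ q` is the sum of the binomial coefficients in the Leibniz rule; the 2 comes
  -- from bounding `‖z‖ ^ p` by `‖z.1‖ ^ p + ‖z.2‖ ^ p`.
  refine ⟨Finset.Iic (p, q), 2 ^ q * (2 * Q), by positivity, fun φ z => ?_⟩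
  set P := (Finset.Iic (p, q)).sup (schwartzSeminormFamily ℂ E ℂ) φ with hP
  have hP0 : 0 ≤ P := apply_nonneg _ _
  have hφ : ∀ a ≤ p, ∀ i ≤ q, ‖z.1‖ ^ a * ‖iteratedFDeriv ℝ i φ z.1‖ ≤ P := fun a ha i hi =>
    (φ.le_seminorm ℂ a i z.1).trans (Finset.le_sup (f := schwartzSeminormFamily ℂ E ℂ)
      (b := (a, i)) (Finset.mem_Iic.2 (Prod.mk_le_mk.2 ⟨ha, hi⟩)) φ)
  have hχ : ∀ a ≤ p, ∀ i ≤ q, ‖z.2‖ ^ a * ‖iteratedFDeriv ℝ i χ z.2‖ ≤ Q := fun a ha i hi =>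
    (χ.le_seminorm ℂ a i z.2).trans (Finset.le_sup (f := schwartzSeminormFamily ℂ F ℂ)
      (b := (a, i)) (Finset.mem_Iic.2 (Prod.mk_le_mk.2 ⟨ha, hi⟩)) χ)
  have hz : ‖z‖ ^ p ≤ ‖z.1‖ ^ p + ‖z.2‖ ^ p := by
    rcases max_cases ‖z.1‖ ‖z.2‖ with h | h
    · rw [Prod.norm_def, h.1]; linarith [pow_nonneg (norm_nonneg z.2) p]
    · rw [Prod.norm_def, h.1]; linarith [pow_nonneg (norm_nonneg z.1) p]
  have hterm : ∀ i ∈ Finset.range (q + 1), ‖z‖ ^ p * ((q.choose i : ℝ) *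
      ‖iteratedFDeriv ℝ i (fun w : E × F => φ w.1) z‖ *
      ‖iteratedFDeriv ℝ (q - i) (fun w : E × F => χ w.2) z‖) ≤ q.choose i * (2 * Q * P) := by
    intro i hi
    have hi' : i ≤ q := Nat.lt_succ_iff.1 (Finset.mem_range.1 hi)
    have h1 := norm_iteratedFDeriv_comp_clm_le φ (ContinuousLinearMap.fst ℝ E F)
      (ContinuousLinearMap.norm_fst_le ..) i z
    have h2 := norm_iteratedFDeriv_comp_clm_le χ (ContinuousLinearMap.snd ℝ E F)
      (ContinuousLinearMap.norm_snd_le ..) (q - i) z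
    simp only [ContinuousLinearMap.coe_fst', ContinuousLinearMap.coe_snd'] at h1 h2
    set A := ‖iteratedFDeriv ℝ i φ z.1‖
    set B := ‖iteratedFDeriv ℝ (q - i) χ z.2‖
    have hA : A ≤ P := by simpa using hφ 0 (Nat.zero_le _) i hi'
    have hB : B ≤ Q := by simpa using hχ 0 (Nat.zero_le _) (q - i) (Nat.sub_le _ _)
    have hA' := hφ p le_rfl i hi'
    have hB' := hχ p le_rfl (q - i) (Nat.sub_le _ _)
    calc _ ≤ (‖z.1‖ ^ p + ‖z.2‖ ^ p) * ((q.choose i : ℝ) * A * B) := by gcongr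
      _ = q.choose i * ((‖z.1‖ ^ p * A) * B + A * (‖z.2‖ ^ p * B)) := by ring
      _ ≤ q.choose i * (P * Q + P * Q) := by gcongr
      _ = _ := by ring
  have hmul := norm_iteratedFDeriv_mul_le (𝕜 := ℝ) (N := ∞)
    (f := fun w : E × F => φ w.1) (g := fun w : E × F => χ w.2)
    ((φ.smooth ⊤).comp contDiff_fst) ((χ.smooth ⊤).comp contDiff_snd) z (n := q)
    (mod_cast le_top)
  calc _ ≤ ‖z‖ ^ p * _ := mul_le_mul_of_nonneg_left hmul (by positivity)
    _ ≤ ∑ i ∈ Finset.range (q + 1), (q.choose i : ℝ) * (2 * Q * P) := by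
      rw [Finset.mul_sum]; exact Finset.sum_le_sum hterm
    _ = 2 ^ q * (2 * Q) * P := by
      rw [← Finset.sum_mul, ← Nat.cast_sum, Nat.sum_range_choose]; push_cast; ring

theorem tensorRight_apply (χ : 𝓢(F, ℂ)) (φ : 𝓢(E, ℂ)) (z : E × F) :
    tensorRight χ φ z = φ z.1 * χ z.2 := rfl

/-! ### The homotopy between a test function and its restriction -/

/-- The map `(t, (x, y)) ↦ (((x, t y), (1 - t) y), t)`. -/
noncomputable def splitMap (z : ℝ × (E × F)) : ((E × F) × F) × ℝ :=
  (((z.2.1, z.1 • z.2.2), (1 - z.1) • z.2.2), z.1)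

theorem hasTemperateGrowth_splitMap :
    (splitMap : ℝ × (E × F) → ((E × F) × F) × ℝ).HasTemperateGrowth := by
  let t : ℝ × (E × F) →L[ℝ] ℝ := ContinuousLinearMap.fst ℝ ℝ (E × F)
  let p : ℝ × (E × F) →L[ℝ] E × F := ContinuousLinearMap.snd ℝ ℝ (E × F)
  let x : ℝ × (E × F) →L[ℝ] E := (ContinuousLinearMap.fst ℝ E F).comp p
  let y : ℝ × (E × F) →L[ℝ] F := (ContinuousLinearMap.snd ℝ E F).comp p
  let I : E →L[ℝ] ((E × F) × F) × ℝ := (ContinuousLinearMap.inl ℝ _ ℝ).comp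
    ((ContinuousLinearMap.inl ℝ _ F).comp (ContinuousLinearMap.inl ℝ E F))
  let J : F →L[ℝ] ((E × F) × F) × ℝ := (ContinuousLinearMap.inl ℝ _ ℝ).comp
    ((ContinuousLinearMap.inl ℝ _ F).comp (ContinuousLinearMap.inr ℝ E F))
  let K : F →L[ℝ] ((E × F) × F) × ℝ := (ContinuousLinearMap.inl ℝ _ ℝ).comp
    (ContinuousLinearMap.inr ℝ (E × F) F)
  let N : ℝ →L[ℝ] ((E × F) × F) × ℝ := ContinuousLinearMap.inr ℝ _ ℝ
  have ht : (⇑t).HasTemperateGrowth := t.hasTemperateGrowth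
  have h1 : (⇑(I.comp x + K.comp y + N.comp t)).HasTemperateGrowth :=
    (I.comp x + K.comp y + N.comp t).hasTemperateGrowth
  -- The map is the linear part `(((x, 0), y), t)` plus the quadratic part `t • (((0, y), -y), 0)`.
  have h2 : (⇑t • ⇑((J - K).comp y)).HasTemperateGrowth :=
    ht.smul ((J - K).comp y).hasTemperateGrowth
  convert h1.add h2 using 1
  ext z <;> simp [splitMap, t, p, x, y, I, J, K, N, add_smul, sub_eq_add_neg]

/-- Since `y = t y + (1 - t) y`, the two scaled copies of `y` cannot both be small. This is why the
path carries the factor `χ((1 - t) y)`: `φ(x, t y)` alone loses decay in `y` at `t = 0`. -/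
theorem norm_le_splitMap {E F : Type*} [NormedAddCommGroup E] [NormedAddCommGroup F]
    [NormedSpace ℝ F] (z : ℝ × (E × F)) : ‖z‖ ≤ 2 * (1 + ‖splitMap z‖) ^ 1 := by
  have h1 : ‖z.1‖ ≤ ‖splitMap z‖ := norm_snd_le (splitMap z)
  have h0 : ‖(splitMap z).1‖ ≤ ‖splitMap z‖ := norm_fst_le (splitMap z)
  have h2 : ‖(1 - z.1) • z.2.2‖ ≤ ‖splitMap z‖ := (norm_snd_le (splitMap z).1).trans h0
  have h3 : ‖(splitMap z).1.1‖ ≤ ‖splitMap z‖ := (norm_fst_le (splitMap z).1).trans h0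
  have h4 : ‖z.2.1‖ ≤ ‖splitMap z‖ := (norm_fst_le (splitMap z).1.1).trans h3
  have h5 : ‖z.1 • z.2.2‖ ≤ ‖splitMap z‖ := (norm_snd_le (splitMap z).1.1).trans h3
  have h6 : ‖z.2.2‖ ≤ ‖z.1 • z.2.2‖ + ‖(1 - z.1) • z.2.2‖ := by
    refine le_trans (le_of_eq ?_) (norm_add_le _ _)
    rw [← add_smul]; simp
  rw [Prod.norm_def, Prod.norm_def, pow_one]
  refine max_le ?_ (max_le ?_ ?_) <;> linarith [norm_nonneg (splitMap z)]

/-- The map sending `Φ` to `(t, (x, y)) ↦ θ(t) Φ((x, t y), (1 - t) y)`. -/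
noncomputable def homotopy (θ : 𝓢(ℝ, ℂ)) : 𝓢((E × F) × F, ℂ) →L[ℂ] 𝓢(ℝ × (E × F), ℂ) :=
  (compCLM ℂ hasTemperateGrowth_splitMap ⟨1, 2, norm_le_splitMap⟩).comp (tensorRight θ)

theorem homotopy_apply (θ : 𝓢(ℝ, ℂ)) (Φ : 𝓢((E × F) × F, ℂ)) (t : ℝ) (z : E × F) :
    homotopy θ Φ (t, z) = Φ ((z.1, t • z.2), (1 - t) • z.2) * θ t := rfl

/-- Where `θ` is locally 1 the cutoff contributes nothing, and the chain rule only sees the velocity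
`((0, y), -y)` of the path. The role of `θ` is to make the family Schwartz in `t` as well. -/
theorem lineDeriv_homotopy_apply (θ : 𝓢(ℝ, ℂ)) (Φ : 𝓢((E × F) × F, ℂ)) (t : ℝ)
    (hθ : ∀ᶠ s in nhds t, θ s = 1) (z : E × F) :
    (∂_{((1 : ℝ), (0 : E × F))} (homotopy θ Φ) : 𝓢(ℝ × (E × F), ℂ)) (t, z) =
      fderiv ℝ Φ ((z.1, t • z.2), (1 - t) • z.2) ((0, z.2), -z.2) := by
  have h1 : HasDerivAt (fun s => homotopy θ Φ (s, z))
      ((∂_{((1 : ℝ), (0 : E × F))} (homotopy θ Φ) : 𝓢(ℝ × (E × F), ℂ)) (t, z)) t := by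
    rw [lineDerivOp_apply_eq_fderiv]
    exact (homotopy θ Φ).differentiableAt.hasFDerivAt.comp_hasDerivAt t
      ((hasDerivAt_id t).prodMk (hasDerivAt_const t z))
  have hs : HasDerivAt (fun s : ℝ => s • z.2) z.2 t := by
    simpa using (hasDerivAt_id t).smul_const z.2
  have hs' : HasDerivAt (fun s : ℝ => (1 - s) • z.2) (-z.2) t := by
    simpa using ((hasDerivAt_id t).const_sub 1).smul_const z.2
  have h2 : HasDerivAt (fun s => Φ ((z.1, s • z.2), (1 - s) • z.2))
      (fderiv ℝ Φ ((z.1, t • z.2), (1 - t) • z.2) ((0, z.2), -z.2)) t :=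
    (Φ.differentiableAt (x := ((z.1, t • z.2), (1 - t) • z.2))).hasFDerivAt.comp_hasDerivAt t
      (((hasDerivAt_const t z.1).prodMk hs).prodMk hs')
  refine h1.unique (h2.congr_of_eventuallyEq ?_)
  filter_upwards [hθ] with s hs
  rw [homotopy_apply, hs, mul_one]

/-- A Schwartz function equal to `1` on the open ball of radius `2` around the origin. -/
theorem exists_schwartz_eq_one (F : Type*) [NormedAddCommGroup F] [NormedSpace ℝ F]
    [FiniteDimensional ℝ F] :
    ∃ χ : 𝓢(F, ℂ), ∀ y ∈ Metric.ball (0 : F) 2, χ y = 1 := by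
  let b : ContDiffBump (0 : F) := ⟨2, 3, by norm_num, by norm_num⟩
  have hc : HasCompactSupport fun y => ((b y : ℝ) : ℂ) :=
    b.hasCompactSupport.comp_left Complex.ofReal_zero
  have hd : ContDiff ℝ ∞ fun y => ((b y : ℝ) : ℂ) := Complex.ofRealCLM.contDiff.comp b.contDiff
  refine ⟨hc.toSchwartzMap hd, fun y hy => ?_⟩
  have : b y = 1 := b.one_of_mem_closedBall (Metric.ball_subset_closedBall hy)
  simp [this]

end SchwartzTensor

/-! ### Distributions annihilated by the coordinates of the second factor -/

section Division

variable {E : Type*} [NormedAddCommGroup E] [NormedSpace ℝ E] {m : ℕ}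

theorem hasTemperateGrowth_snd_coord (j : Fin m) :
    (fun z : E × EuclideanSpace ℝ (Fin m) => ((z.2 j : ℝ) : ℂ)).HasTemperateGrowth :=
  (Complex.ofRealCLM.comp ((EuclideanSpace.proj j : EuclideanSpace ℝ (Fin m) →L[ℝ] ℝ).comp
    (ContinuousLinearMap.snd ℝ E (EuclideanSpace ℝ (Fin m))))).hasTemperateGrowth

/-- The velocity `((0, y), -y)` is linear in `y`; expanding it in the standard basis extracts the
factors `y_j`. -/
theorem slice_lineDeriv_homotopy (θ : 𝓢(ℝ, ℂ)) (Φ : 𝓢((E × EuclideanSpace ℝ (Fin m)) ×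
    EuclideanSpace ℝ (Fin m), ℂ)) (t : ℝ) (hθ : ∀ᶠ s in nhds t, θ s = 1) :
    slice t (∂_{((1 : ℝ), (0 : E × EuclideanSpace ℝ (Fin m)))} (homotopy θ Φ)) =
      ∑ j : Fin m, SchwartzMap.smulLeftCLM ℂ
        (fun z : E × EuclideanSpace ℝ (Fin m) => ((z.2 j : ℝ) : ℂ))
        (slice t (homotopy θ (∂_{(((0 : E), EuclideanSpace.single j (1 : ℝ)),
          -EuclideanSpace.single j (1 : ℝ))} Φ))) := by
  ext z
  let L : EuclideanSpace ℝ (Fin m) →ₗ[ℝ]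
      (E × EuclideanSpace ℝ (Fin m)) × EuclideanSpace ℝ (Fin m) :=
    (LinearMap.inr ℝ E _).prod (-LinearMap.id)
  have hz : ((0, z.2), -z.2) = ∑ j, z.2 j • L (EuclideanSpace.single j 1) := by
    have : L z.2 = L (∑ j, z.2 j • EuclideanSpace.single j 1) := by
      congr 1
      simpa using ((EuclideanSpace.basisFun (Fin m) ℝ).sum_repr z.2).symm
    simp only [map_sum, map_smul] at this
    exact this
  rw [slice_apply, lineDeriv_homotopy_apply θ Φ t hθ, hz, map_sum, sum_apply]
  refine Finset.sum_congr rfl fun j _ => ?_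
  rw [SchwartzMap.smulLeftCLM_apply_apply (hasTemperateGrowth_snd_coord j), slice_apply,
    homotopy_apply, hθ.self_of_nhds, lineDerivOp_apply_eq_fderiv, map_smul]
  simp [L]

variable [FiniteDimensional ℝ E]

/-- A tempered distribution annihilated by the coordinates of the second factor only depends on
the restriction of the test function to the first factor. -/
theorem apply_eq_apply_tensorRight (T : 𝓢'(E × EuclideanSpace ℝ (Fin m), ℂ))
    (hT : ∀ j, TemperedDistribution.smulLeftCLM ℂ
      (fun z : E × EuclideanSpace ℝ (Fin m) => ((z.2 j : ℝ) : ℂ)) T = 0)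
    (χ : 𝓢(EuclideanSpace ℝ (Fin m), ℂ)) (hχ : χ 0 = 1)
    (φ : 𝓢(E × EuclideanSpace ℝ (Fin m), ℂ)) :
    T φ = T (tensorRight χ (partialEvalCLM (TemperedDistribution.delta 0) φ)) := by
  obtain ⟨θ, hθ⟩ := exists_schwartz_eq_one ℝ
  set Ψ := homotopy θ (tensorRight χ φ) with hΨ
  have hder : ∀ t ∈ Metric.ball (0 : ℝ) 2, HasDerivAt (partialEval T Ψ) 0 t := by
    intro t ht
    obtain ⟨L, hL, hL'⟩ := hasFDerivAt_partialEval T Ψ t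
    have h := hL.hasDerivAt
    rw [hL', partialEval, slice_lineDeriv_homotopy θ _ t
      (Filter.eventually_of_mem (Metric.isOpen_ball.mem_nhds ht) hθ), map_sum] at h
    convert h using 1
    -- Each summand is `T` applied to `y_j` times a Schwartz function, i.e. a value of `y_j T = 0`.
    refine (Finset.sum_eq_zero fun j _ => ?_).symm
    rw [← TemperedDistribution.smulLeftCLM_apply_apply, hT]
    rfl
  have h0 : (0 : ℝ) ∈ Metric.ball (0 : ℝ) 2 := by simp
  have h1 : (1 : ℝ) ∈ Metric.ball (0 : ℝ) 2 := by simp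
  have heq : partialEval T Ψ 1 = partialEval T Ψ 0 :=
    (convex_ball (0 : ℝ) 2).is_const_of_fderivWithin_eq_zero (𝕜 := ℝ)
      (fun t ht => (hder t ht).differentiableAt.differentiableWithinAt)
      (fun t ht => by
        rw [fderivWithin_of_isOpen Metric.isOpen_ball ht, (hder t ht).hasFDerivAt.fderiv]
        ext; simp) h1 h0
  have e1 : slice 1 Ψ = φ := by
    ext z
    simp [slice_apply, hΨ, homotopy_apply, tensorRight_apply, hθ 1 h1, hχ]
  have e0 : slice 0 Ψ = tensorRight χ (partialEvalCLM (TemperedDistribution.delta 0) φ) := by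
    ext z
    simp [slice_apply, hΨ, homotopy_apply, tensorRight_apply, hθ 0 h0, partialEvalCLM_apply]
  simpa only [partialEval, e1, e0] using heq

/-- Take `f ψ = T (ψ ⊗ χ)`: pairing with `δ` in the second variable is restriction to `y = 0`. -/
theorem exists_eq_tensorProd_delta
    (T : 𝓢'(E × EuclideanSpace ℝ (Fin m), ℂ))
    (hT : ∀ j, TemperedDistribution.smulLeftCLM ℂ
      (fun z : E × EuclideanSpace ℝ (Fin m) => ((z.2 j : ℝ) : ℂ)) T = 0) :
    ∃ f : 𝓢'(E, ℂ), T = tensorProd f (TemperedDistribution.delta 0) := by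
  obtain ⟨χ, hχ⟩ := exists_schwartz_eq_one (EuclideanSpace ℝ (Fin m))
  refine ⟨PointwiseConvergenceCLM.precomp ℂ (tensorRight χ) T, ?_⟩
  ext φ
  exact apply_eq_apply_tensorRight T hT χ (hχ 0 (by simp)) φ

end Division

end TensorDistribution

namespace TensorDistribution

/-! ### Orthogonal changes of variables and products with linear forms -/

section ChangeVar

variable {n k : ℕ}

theorem transposeEquiv_apply (U : Matrix.orthogonalGroup (Fin n) ℝ)
    (x : EuclideanSpace ℝ (Fin n)) (i : Fin n) :
    transposeEquiv U x i = ∑ l, (U : Matrix (Fin n) (Fin n) ℝ) l i * x l := by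
  change (Matrix.toEuclideanCLM (𝕜 := ℝ) (U : Matrix (Fin n) (Fin n) ℝ).transpose x) i = _
  simp [Matrix.mulVec, dotProduct]

theorem transposeEquiv_inv_apply (U : Matrix.orthogonalGroup (Fin n) ℝ)
    (x : EuclideanSpace ℝ (Fin n)) : transposeEquiv U⁻¹ (transposeEquiv U x) = x := by
  refine Eq.trans ?_ ((transposeEquiv U).symm_apply_apply x)
  -- The inverse in the orthogonal group is the transpose, so both sides unfold to the same matrix
  -- action.
  rfl

theorem changeVar_changeVar_inv (U : Matrix.orthogonalGroup (Fin n) ℝ)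
    (T : 𝓢'(EuclideanSpace ℝ (Fin n), ℂ)) : changeVar U (changeVar U⁻¹ T) = T := by
  ext φ
  change T _ = T φ
  congr 1
  ext x
  change φ (transposeEquiv U (transposeEquiv U⁻¹ x)) = φ x
  have := transposeEquiv_inv_apply U⁻¹ x
  rw [inv_inv] at this
  rw [this]

/-- The product of a distribution with the linear form `x ↦ ∑ i, c i * x i`. -/
noncomputable def linearMul (T : 𝓢'(EuclideanSpace ℝ (Fin n), ℂ)) :
    EuclideanSpace ℝ (Fin n) →ₗ[ℝ] 𝓢'(EuclideanSpace ℝ (Fin n), ℂ) :=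
  (Fintype.linearCombination ℝ fun i => coordMul i T) ∘ₗ
    (WithLp.linearEquiv 2 ℝ (Fin n → ℝ)).toLinearMap

theorem linearMul_apply (T : 𝓢'(EuclideanSpace ℝ (Fin n), ℂ)) (c : EuclideanSpace ℝ (Fin n)) :
    linearMul T c = ∑ i, c i • coordMul i T := by
  simp [linearMul, Fintype.linearCombination_apply]

theorem range_linearMul (T : 𝓢'(EuclideanSpace ℝ (Fin n), ℂ)) :
    LinearMap.range (linearMul T) = Submodule.span ℝ (Set.range fun i => coordMul i T) := by
  rw [linearMul, LinearMap.range_comp_of_range_eq_top _ (LinearEquiv.range _),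
    Fintype.range_linearCombination]

/-- The `i`-th coordinate of `Uᵀ x` is `∑ l, U l i * x l`, and it factors out of `(x_i φ)(Uᵀ ·)`. -/
theorem coordMul_changeVar (U : Matrix.orthogonalGroup (Fin n) ℝ)
    (T : 𝓢'(EuclideanSpace ℝ (Fin n), ℂ)) (i : Fin n) :
    coordMul i (changeVar U T) =
      ∑ l, (U : Matrix (Fin n) (Fin n) ℝ) l i • changeVar U (coordMul l T) := by
  ext φ
  let C := compCLMOfContinuousLinearEquiv ℂ (F := ℂ) (transposeEquiv U)
  let M : Fin n → 𝓢(EuclideanSpace ℝ (Fin n), ℂ) →L[ℂ] 𝓢(EuclideanSpace ℝ (Fin n), ℂ) :=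
    fun l => SchwartzMap.smulLeftCLM ℂ fun x => ((x l : ℝ) : ℂ)
  have h : C (M i φ) = ∑ l, ((U : Matrix (Fin n) (Fin n) ℝ) l i : ℂ) • M l (C φ) := by
    ext x
    have hM : ∀ l (ψ : 𝓢(EuclideanSpace ℝ (Fin n), ℂ)) y, M l ψ y = (y l : ℂ) * ψ y :=
      fun l ψ y => SchwartzMap.smulLeftCLM_apply_apply (coord_hasTemperateGrowth l) ψ y
    have hC : ∀ (ψ : 𝓢(EuclideanSpace ℝ (Fin n), ℂ)) y, C ψ y = ψ (transposeEquiv U y) :=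
      fun ψ y => rfl
    simp only [hC, hM, sum_apply, _root_.smul_apply, smul_eq_mul, transposeEquiv_apply]
    push_cast
    rw [Finset.sum_mul]
    exact Finset.sum_congr rfl fun l _ => mul_assoc _ _ _
  have h2 : coordMul i (changeVar U T) φ = T (C (M i φ)) := rfl
  rw [h2, h, map_sum, sum_apply]
  refine Finset.sum_congr rfl fun l _ => ?_
  rw [map_smul, _root_.smul_apply, Complex.real_smul]
  rfl

theorem changeVar_sum_smul (U : Matrix.orthogonalGroup (Fin n) ℝ) (c : Fin n → ℝ)
    (S : Fin n → 𝓢'(EuclideanSpace ℝ (Fin n), ℂ)) :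
    changeVar U (∑ l, c l • S l) = ∑ l, c l • changeVar U (S l) := by
  ext φ
  change (∑ l, c l • S l) _ = _
  simp only [sum_apply, _root_.smul_apply]
  rfl

/-- The delta evaluates the test function at points `(x, 0)`, where the coordinates with
(zero-based) index at least `k` vanish. -/
theorem coordMul_euclideanTensor_delta (hk : k ≤ n) (f : 𝓢'(EuclideanSpace ℝ (Fin k), ℂ))
    (l : Fin n) (hl : k ≤ l) :
    coordMul l (euclideanTensor hk f (TemperedDistribution.delta 0)) = 0 := by
  ext φ
  change f (partialEvalCLM (TemperedDistribution.delta 0)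
    (compCLMOfContinuousLinearEquiv ℂ (splitEquiv hk).symm
      (SchwartzMap.smulLeftCLM ℂ (fun x => ((x l : ℝ) : ℂ)) φ))) = 0
  convert map_zero f
  ext x
  rw [partialEvalCLM_apply]
  change SchwartzMap.smulLeftCLM ℂ (fun x => ((x l : ℝ) : ℂ)) φ ((splitEquiv hk).symm (x, 0)) = 0
  rw [SchwartzMap.smulLeftCLM_apply_apply (coord_hasTemperateGrowth l)]
  have h := splitEquiv_snd hk ((splitEquiv hk).symm (x, 0)) ⟨l - k, by omega⟩
  rw [ContinuousLinearEquiv.apply_symm_apply] at h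
  have hl' : (⟨k + (l - k), by omega⟩ : Fin n) = l := Fin.ext (by simp; omega)
  simp only [hl'] at h
  rw [← h]
  simp

theorem exists_eq_euclideanTensor_delta (hk : k ≤ n) (T : 𝓢'(EuclideanSpace ℝ (Fin n), ℂ))
    (hT : ∀ l : Fin n, k ≤ l → coordMul l T = 0) :
    ∃ f, T = euclideanTensor hk f (TemperedDistribution.delta 0) := by
  obtain ⟨f, hf⟩ := exists_eq_tensorProd_delta
    (PointwiseConvergenceCLM.precomp ℂ (compCLMOfContinuousLinearEquiv ℂ (splitEquiv hk)) T)
    (fun j => by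
      ext φ
      have h := DFunLike.congr_fun (hT ⟨k + j, by omega⟩ (by simp))
        (compCLMOfContinuousLinearEquiv ℂ (splitEquiv hk) φ)
      refine Eq.trans ?_ h
      change T _ = T _
      congr 1
      ext x
      exact (SchwartzMap.smulLeftCLM_apply_apply (hasTemperateGrowth_snd_coord j) φ
        (splitEquiv hk x)).trans
          (SchwartzMap.smulLeftCLM_apply_apply (coord_hasTemperateGrowth ⟨k + j, by omega⟩)
            (compCLMOfContinuousLinearEquiv ℂ (splitEquiv hk) φ) x).symm)
  refine ⟨f, ?_⟩
  ext φ
  refine Eq.trans ?_ (DFunLike.congr_fun hf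
    (compCLMOfContinuousLinearEquiv ℂ (splitEquiv hk).symm φ))
  change T _ = T _
  congr 1
  ext x
  change φ x = φ ((splitEquiv hk).symm (splitEquiv hk x))
  simp

/-- Only the first `k` terms survive in `coordMul_changeVar`, so `k` distributions span all the
products. -/
theorem finrank_span_coordMul_changeVar_le (hk : k ≤ n)
    (U : Matrix.orthogonalGroup (Fin n) ℝ) (T : 𝓢'(EuclideanSpace ℝ (Fin n), ℂ))
    (hT : ∀ l : Fin n, k ≤ l → coordMul l T = 0) :
    Module.finrank ℝ (Submodule.span ℝ
      (Set.range fun i => coordMul i (changeVar U T))) ≤ k := by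
  set W := Submodule.span ℝ
    (Set.range fun l : Fin k => changeVar U (coordMul (Fin.castLE hk l) T)) with hW
  have hle : Submodule.span ℝ (Set.range fun i => coordMul i (changeVar U T)) ≤ W := by
    rw [Submodule.span_le]
    rintro _ ⟨i, rfl⟩
    change coordMul i (changeVar U T) ∈ W
    rw [coordMul_changeVar]
    refine Submodule.sum_mem _ fun l _ => Submodule.smul_mem _ _ ?_
    by_cases hl : (l : ℕ) < k
    · exact Submodule.subset_span ⟨⟨l, hl⟩, rfl⟩
    · rw [hT l (not_lt.1 hl)]
      exact W.zero_mem
  have : FiniteDimensional ℝ W := FiniteDimensional.span_of_finite ℝ (Set.finite_range _)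
  refine (Submodule.finrank_mono hle).trans ?_
  exact (finrank_range_le_card _).trans_eq (Fintype.card_fin k)

/-- A subspace of dimension at least `n - k` contains the last `n - k` rows of some orthogonal
matrix. -/
theorem exists_orthogonal_rows_mem (W : Submodule ℝ (EuclideanSpace ℝ (Fin n)))
    (hW : n ≤ Module.finrank ℝ W + k) :
    ∃ U : Matrix.orthogonalGroup (Fin n) ℝ, ∀ l : Fin n, k ≤ l →
      WithLp.toLp 2 ((U : Matrix (Fin n) (Fin n) ℝ) l) ∈ W := by
  let e := stdOrthonormalBasis ℝ W
  -- Only indices `l ≥ k` matter; the value 0 and the truncated subtraction for `l < k` are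
  -- placeholders that the restriction to `s` discards.
  let v : Fin n → EuclideanSpace ℝ (Fin n) := fun l =>
    if h : l - k < Module.finrank ℝ W then e ⟨l - k, h⟩ else 0
  have hv : ∀ l : Fin n, k ≤ l → ∃ h : l - k < Module.finrank ℝ W, v l = e ⟨l - k, h⟩ := by
    intro l hl
    have h : l - k < Module.finrank ℝ W := by omega
    exact ⟨h, dif_pos h⟩
  let s : Set (Fin n) := {l | k ≤ l}
  have ho : Orthonormal ℝ (s.domRestrict v) := by
    have h1 := (e.orthonormal.comp_linearIsometry W.subtypeₗᵢ).comp
      (fun l : s => (⟨l - k, (hv l l.2).1⟩ : Fin (Module.finrank ℝ W)))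
      (fun a b hab => by
        have ha : k ≤ (a : Fin n) := a.2
        have hb : k ≤ (b : Fin n) := b.2
        have := Fin.mk.inj_iff.1 hab
        exact Subtype.ext (Fin.ext (by omega)))
    convert h1 using 1
    ext1 l
    exact (hv l l.2).2
  obtain ⟨b, hb⟩ := ho.exists_orthonormalBasis_extension_of_card_eq (by simp)
  let A : Matrix (Fin n) (Fin n) ℝ := Matrix.of fun l => b l
  have hA : A ∈ Matrix.orthogonalGroup (Fin n) ℝ := by
    -- The entries of `A * Aᵀ` are the inner products of the rows, which are the basis vectors `b
    -- l`.
    rw [Matrix.mem_orthogonalGroup_iff]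
    ext i j
    have := orthonormal_iff_ite.1 b.orthonormal i j
    rw [PiLp.inner_apply] at this
    simpa [A, Matrix.mul_apply, Matrix.one_apply, mul_comm] using this
  refine ⟨⟨A, hA⟩, fun l hl => ?_⟩
  obtain ⟨h, hl'⟩ := hv l hl
  have : WithLp.toLp 2 (A l) = b l := rfl
  rw [this, hb l hl, hl']
  exact (e _).2

end ChangeVar

end TensorDistribution

/-! ### The characterization by rank and nullity -/

theorem theorem2 (n k : ℕ) (hk : k ≤ n) (T : 𝓢'(EuclideanSpace ℝ (Fin n), ℂ)) :
    T ∈ TensorDistribution.GPrime hk ↔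
      Module.finrank ℝ (Submodule.span ℝ
        (Set.range fun i : Fin n => TensorDistribution.coordMul i T)) ≤ k := by
  open TensorDistribution in
  constructor
  · rintro ⟨f, U, rfl⟩
    exact finrank_span_coordMul_changeVar_le hk U _ (coordMul_euclideanTensor_delta hk f)
  · intro h
    rw [← range_linearMul] at h
    have hrank := (linearMul T).finrank_range_add_finrank_ker
    rw [finrank_euclideanSpace_fin] at hrank
    obtain ⟨U, hU⟩ := exists_orthogonal_rows_mem (k := k) (LinearMap.ker (linearMul T)) (by omega)
    obtain ⟨f, hf⟩ := exists_eq_euclideanTensor_delta hk (changeVar U⁻¹ T) fun l hl => by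
      have hker := LinearMap.mem_ker.1 (hU l hl)
      rw [linearMul_apply] at hker
      -- Changing variables by `U⁻¹` uses its column `l`, which is row `l` of `U`; hence rows, not
      -- columns, were placed in the kernel.
      have hinv : ∀ i, ((U⁻¹ : Matrix.orthogonalGroup (Fin n) ℝ) : Matrix (Fin n) (Fin n) ℝ) i l =
          (U : Matrix (Fin n) (Fin n) ℝ) l i := fun i => rfl
      rw [coordMul_changeVar]
      simp only [hinv]
      rw [← changeVar_sum_smul]
      refine (congrArg (changeVar U⁻¹) hker).trans ?_
      rfl
    exact ⟨f, U, by rw [← hf, changeVar_changeVar_inv]⟩
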